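/- Let $1 \le k \le n$ be integers and let $\mathbb{Q}[\mathbf{x}_n] = \mathbb{Q}[x_1,\dots,x_n]$, on which the symmetric group $\mathfrak{S}_n$ acts by $\sigma \cdot x_i = x_{\sigma(i)}$. A word $w = w_1 \cdots w_n$ over the positive integers is *packed* if, for every $i \ge 1$, whenever the letter $i+1$ appears in $w$, so does $i$. Let $\mathcal{W}_n$ be the set of packed words of length $n$, and let $\mathcal{W}_{n,k} \subseteq \mathcal{W}_n$ be the set of those in which all of the letters $1,\dots,k$ appear; $\mathfrak{S}_n$ acts on both sets by permuting the positions of the letters. Let $e_d$ be the elementary symmetric polynomial of degree $d$ in $x_1,\dots,x_n$, and let $e_d^{(i)}$ be the one in the variables other than $x_i$, with $e_0^{(i)} = 1$ and $e_d^{(i)} = 0$ for $d<0$. Put $$J_n = \langle x_i^d \, e_{n-r}^{(i)} : 1 \le i \le n,\ 1 \le r \le d \rangle, \qquad J_{n,k} = J_n + \langle e_n, e_{n-1}, \dots, e_{n-k+1} \rangle,$$ $S_n = \mathbb{Q}[\mathbf{x}_n]/J_n$ and $S_{n,k} = \mathbb{Q}[\mathbf{x}_n]/J_{n,k}$. For distinct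 $\alpha_1,\dots,\alpha_n \in \mathbb{Q}$ let $$X_{n,k} = \{(\alpha_{w_1},\dots,\alpha_{w_n}) : w \in \mathcal{W}_{n,k}\} \subseteq \mathbb{Q}^n .$$ For $X \subseteq \mathbb{Q}^n$ let $\mathbf{I}(X) \subseteq \mathbb{Q}[\mathbf{x}_n]$ be the ideal of polynomials vanishing on $X$, and let $\mathbf{T}(X)$ be the ideal generated by the highest degree homogeneous components of the nonzero elements of $\mathbf{I}(X)$. **Theorem.** For every choice of distinct $\alpha_1,\dots,\alpha_n \in \mathbb{Q}$ we have $J_{n,k} = \mathbf{T}(X_{n,k})$. Consequently, $S_{n,k} \cong \mathbb{Q}[\mathcal{W}_{n,k}]$ as ungraded $\mathfrak{S}_n$-modules. In particular, $S_n \cong \mathbb{Q}[\mathcal{W}_n]$ as ungraded $\mathfrak{S}_n$-modules, and $S_n$ is finite-dimensional with $\dim_{\mathbb{Q}} S_n = |\mathcal{W}_n|$. -/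

import Mathlib

open MvPolynomial

noncomputable section

namespace PackedWordQuotient

/-! ### Packed words -/

/-- A word `w = w₁ ⋯ wₙ` over the positive integers is packed if, whenever the letter `i + 1`
appears in it, so does the letter `i`. -/
def IsPacked {n : ℕ} (w : Fin n → ℕ+) : Prop :=
  ∀ i : ℕ+, i + 1 ∈ Set.range w → i ∈ Set.range w

/-- `𝒲ₙ`: packed words of length `n`. -/
def PackedWord (n : ℕ) : Type :=
  {w : Fin n → ℕ+ // IsPacked w}

/-- `𝒲ₙ,ₖ`: packed words of length `n` in which all the letters `1, …, k` appear. -/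
def PackedWordGE (n k : ℕ) : Type :=
  {w : Fin n → ℕ+ // IsPacked w ∧ ∀ i : ℕ+, (i : ℕ) ≤ k → i ∈ Set.range w}

theorem IsPacked.comp_perm {n : ℕ} {w : Fin n → ℕ+} (hw : IsPacked w)
    (σ : Equiv.Perm (Fin n)) : IsPacked (w ∘ σ) := by
  intro i hi
  rw [σ.surjective.range_comp] at hi ⊢
  exact hw i hi

/-- The symmetric group permutes the positions of the letters: the letter in position `j`
moves to position `σ j`. -/
instance (n : ℕ) : MulAction (Equiv.Perm (Fin n)) (PackedWord n) where
  smul σ w := ⟨w.1 ∘ ⇑(σ⁻¹), w.2.comp_perm σ⁻¹⟩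
  one_smul _ := rfl
  mul_smul σ τ w := Subtype.ext (by
    change w.1 ∘ ⇑((σ * τ)⁻¹) = (w.1 ∘ ⇑(τ⁻¹)) ∘ ⇑(σ⁻¹)
    rw [mul_inv_rev]
    rfl)

instance (n k : ℕ) : MulAction (Equiv.Perm (Fin n)) (PackedWordGE n k) where
  smul σ w := ⟨w.1 ∘ ⇑(σ⁻¹), w.2.1.comp_perm σ⁻¹, fun i hi => by
    rw [(σ⁻¹).surjective.range_comp]
    exact w.2.2 i hi⟩
  one_smul _ := rfl
  mul_smul σ τ w := Subtype.ext (by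
    change w.1 ∘ ⇑((σ * τ)⁻¹) = (w.1 ∘ ⇑(τ⁻¹)) ∘ ⇑(σ⁻¹)
    rw [mul_inv_rev]
    rfl)

theorem IsPacked.mem_range_of_le {n : ℕ} {w : Fin n → ℕ+} (hw : IsPacked w) (m : ℕ+) :
    m ∈ Set.range w → ∀ i ≤ m, i ∈ Set.range w := by
  induction m using PNat.recOn with
  | one =>
    intro h i hi
    rwa [le_antisymm hi one_le]
  | succ m ih =>
    intro h i hi
    rcases hi.eq_or_lt with rfl | hlt
    · exact h
    · exact ih (hw m h) i (PNat.lt_add_one_iff.mp hlt)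

/-- The letters of a packed word of length `n` are at most `n`. -/
theorem IsPacked.letter_le {n : ℕ} {w : Fin n → ℕ+} (hw : IsPacked w) (j : Fin n) :
    (w j : ℕ) ≤ n := by
  have hsub : Finset.Icc 1 (w j) ⊆ Finset.univ.image w := by
    intro i hi
    obtain ⟨a, ha⟩ := hw.mem_range_of_le (w j) ⟨j, rfl⟩ i (Finset.mem_Icc.mp hi).2
    exact Finset.mem_image.mpr ⟨a, Finset.mem_univ _, ha⟩
  have h := (Finset.card_le_card hsub).trans Finset.card_image_le
  simpa using h

/-! ### The point locus and the associated graded ideal -/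

/-- The point `(α_{w₁}, …, α_{wₙ})` of a packed word `w`. The parameters `α₁, …, αₙ` are
indexed by `Fin n`, so that `α_m` is the value of `α` at `m - 1`. -/
def point {n : ℕ} (α : Fin n → ℚ) (w : Fin n → ℕ+) (hw : IsPacked w) : Fin n → ℚ :=
  fun j => α ⟨(w j : ℕ) - 1, by have := hw.letter_le j; have := (w j).pos; omega⟩

/-- The locus `Xₙ,ₖ ⊆ ℚⁿ` of the points of all words in `𝒲ₙ,ₖ`. -/
def locus {n : ℕ} (α : Fin n → ℚ) (k : ℕ) : Set (Fin n → ℚ) :=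
  Set.range fun w : PackedWordGE n k => point α w.1 w.2.1

/-- The highest degree component of a nonzero polynomial. -/
def topComponent {n : ℕ} (f : MvPolynomial (Fin n) ℚ) : MvPolynomial (Fin n) ℚ :=
  homogeneousComponent f.totalDegree f

/-- The associated graded ideal `T(X)` of the ideal `I(X)` of polynomials vanishing on `X`. -/
def assocGradedIdeal {n : ℕ} (X : Set (Fin n → ℚ)) : Ideal (MvPolynomial (Fin n) ℚ) :=
  Ideal.span {g | ∃ f ∈ vanishingIdeal ℚ X, f ≠ 0 ∧ g = topComponent f}

/-! ### The ideals `Jₙ` and `Jₙ,ₖ` -/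

/-- `e_d` in the variables other than `x_i`. -/
def esymmOmit {n : ℕ} (i : Fin n) (d : ℕ) : MvPolynomial (Fin n) ℚ :=
  ∑ s ∈ (Finset.univ.erase i).powersetCard d, ∏ j ∈ s, X j

/-- The generators `x_i ^ d * e_{n-r}^{(i)}` with `1 ≤ r ≤ d`. Those with `r > n` are zero (an
elementary symmetric polynomial of negative degree is zero) and are left out. -/
def gensJ (n : ℕ) : Set (MvPolynomial (Fin n) ℚ) :=
  {g | ∃ (i : Fin n) (d r : ℕ), 1 ≤ r ∧ r ≤ d ∧ r ≤ n ∧ g = X i ^ d * esymmOmit i (n - r)}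

/-- The ideal `Jₙ`. -/
def idealJ (n : ℕ) : Ideal (MvPolynomial (Fin n) ℚ) :=
  Ideal.span (gensJ n)

/-- The ideal `Jₙ,ₖ = Jₙ + ⟨eₙ, eₙ₋₁, …, eₙ₋ₖ₊₁⟩`. -/
def idealJGE (n k : ℕ) : Ideal (MvPolynomial (Fin n) ℚ) :=
  idealJ n ⊔ Ideal.span {g | ∃ d : ℕ, n + 1 ≤ d + k ∧ d ≤ n ∧ g = esymm (Fin n) ℚ d}

theorem rename_esymmOmit {n : ℕ} (σ : Equiv.Perm (Fin n)) (i : Fin n) (d : ℕ) :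
    rename σ (esymmOmit i d) = esymmOmit (σ i) d := by
  unfold esymmOmit
  have h : (Finset.univ.erase (σ i)) = (Finset.univ.erase i).map σ.toEmbedding := by
    ext j
    simp
  rw [h, Finset.powersetCard_map, Finset.sum_map, map_sum]
  refine Finset.sum_congr rfl fun s _ => ?_
  simp [Finset.mapEmbedding_apply, map_prod]

theorem idealJ_le_comap (n : ℕ) (σ : Equiv.Perm (Fin n)) :
    idealJ n ≤ (idealJ n).comap (rename (R := ℚ) σ) := by
  refine Ideal.span_le.mpr ?_
  rintro _ ⟨i, d, r, h1, h2, h3, rfl⟩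
  refine Ideal.subset_span ⟨σ i, d, r, h1, h2, h3, ?_⟩
  simp [rename_esymmOmit]

theorem idealJGE_le_comap (n k : ℕ) (σ : Equiv.Perm (Fin n)) :
    idealJGE n k ≤ (idealJGE n k).comap (rename (R := ℚ) σ) := by
  refine sup_le ((idealJ_le_comap n σ).trans (Ideal.comap_mono le_sup_left)) ?_
  refine Ideal.span_le.mpr ?_
  rintro _ ⟨d, h1, h2, rfl⟩
  refine (le_sup_right : _ ≤ idealJGE n k) (Ideal.subset_span ⟨d, h1, h2, ?_⟩)
  exact esymm_isSymmetric (Fin n) ℚ d σ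

/-! ### The quotient rings as representations of the symmetric group -/

/-- The representation of the symmetric group on `ℚ[x₁, …, xₙ] / I` induced by
`σ • x_i = x_{σ i}`, for an ideal `I` that is stable under this action. -/
def quotientRep {n : ℕ} (I : Ideal (MvPolynomial (Fin n) ℚ))
    (hI : ∀ σ : Equiv.Perm (Fin n), I ≤ I.comap (rename (R := ℚ) σ)) :
    Representation ℚ (Equiv.Perm (Fin n)) (MvPolynomial (Fin n) ℚ ⧸ I) where
  toFun σ := (Ideal.quotientMapₐ I (rename (R := ℚ) σ) (hI σ)).toLinearMap
  map_one' := by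
    refine LinearMap.ext fun x => ?_
    obtain ⟨p, rfl⟩ := Ideal.Quotient.mk_surjective x
    simp [Equiv.Perm.coe_one]
  map_mul' σ τ := by
    refine LinearMap.ext fun x => ?_
    obtain ⟨p, rfl⟩ := Ideal.Quotient.mk_surjective x
    simp [Equiv.Perm.coe_mul, rename_rename]

/-- `Sₙ = ℚ[x₁, …, xₙ] / Jₙ`. -/
abbrev RingS (n : ℕ) : Type := MvPolynomial (Fin n) ℚ ⧸ idealJ n

/-- `Sₙ,ₖ = ℚ[x₁, …, xₙ] / Jₙ,ₖ`. -/
abbrev RingSGE (n k : ℕ) : Type := MvPolynomial (Fin n) ℚ ⧸ idealJGE n k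

/-- `Sₙ` as an ungraded module of the symmetric group. -/
def repS (n : ℕ) : Representation ℚ (Equiv.Perm (Fin n)) (RingS n) :=
  quotientRep (idealJ n) (idealJ_le_comap n)

/-- `Sₙ,ₖ` as an ungraded module of the symmetric group. -/
def repSGE (n k : ℕ) : Representation ℚ (Equiv.Perm (Fin n)) (RingSGE n k) :=
  quotientRep (idealJGE n k) (idealJGE_le_comap n k)

end PackedWordQuotient

end

/-!
Adding `eₙ₋ₖ` to `Jₙ,ₖ` gives `Jₙ,ₖ₊₁`, and multiplication by `eₙ₋ₖ` maps the generalized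
coinvariant ring `ℚ[x₁, …, xₙ] / ⟨xᵢ ^ k, eₙ, …, eₙ₋ₖ₊₁⟩` onto the kernel of `Sₙ,ₖ → Sₙ,ₖ₊₁`. The
dimension of that ring is at most the number of surjections from `n` positions onto `k` letters,
so summing over the number of letters gives `dim Sₙ,ₖ ≤ |𝒲ₙ,ₖ|`.

The divided difference of `∏ (t + xⱼ)` in `t`, at the nodes `-α₁, …, -αᵣ`, has an elementary
symmetric polynomial as leading form and vanishes wherever each of `α₁, …, αᵣ` is the value of
some `xⱼ`. On the words containing `1, …, k` this gives the generators `e_d`. For the others, omit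
`xᵢ` from the product and multiply by `(xᵢ - α₁) ⋯ (xᵢ - αᵣ)`: in a packed word `w` either
`wᵢ ≤ r`, or all the letters `1, …, r` occur away from position `i`. Hence `Jₙ,ₖ ⊆ T(Xₙ,ₖ)`.

By Maschke's theorem the filtration by degree of the functions on `Xₙ,ₖ` splits equivariantly,
which gives an equivariant surjection `ℚ[x₁, …, xₙ] → ℚ[𝒲ₙ,ₖ]` that kills `T(Xₙ,ₖ)`. The dimension
bound forces its kernel to be `Jₙ,ₖ`, so `Jₙ,ₖ = T(Xₙ,ₖ)`.
-/

noncomputable section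

namespace PackedWordQuotient

/-! ### Generalized coinvariants and the dimension of `Sₙ,ₖ` -/

section CodimensionBounds

variable {K A : Type*} [CommRing K] [CommRing A] [Algebra K A]

theorem rank_quotient_le_of_le {I J : Ideal A} (hIJ : I ≤ J) :
    Module.rank K (A ⧸ J) ≤ Module.rank K (A ⧸ I) :=
  (Ideal.Quotient.factorₐ K hIJ).toLinearMap.rank_le_of_surjective
    (Ideal.Quotient.factor_surjective hIJ)

theorem rank_quotient_eq_zero_of_one_mem [Nontrivial K] {I : Ideal A} (h : (1 : A) ∈ I) :
    Module.rank K (A ⧸ I) = 0 := by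
  rw [I.eq_top_of_isUnit_mem h isUnit_one, rank_subsingleton']

theorem rank_quotient_le_add [IsDomain K] {I J : Ideal A} {g : A} (hg : ∀ a ∈ J, g * a ∈ I) :
    Module.rank K (A ⧸ I) ≤
      Module.rank K (A ⧸ (I ⊔ Ideal.span {g})) + Module.rank K (A ⧸ J) := by
  let mulByG : (A ⧸ J) →ₗ[K] A ⧸ I :=
    (J.restrictScalars K).mapQ (I.restrictScalars K) (LinearMap.mulLeft K g) hg
  let toSup := (Ideal.Quotient.factorₐ K (le_sup_left : I ≤ I ⊔ Ideal.span {g})).toLinearMap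
  have ker_le : LinearMap.ker toSup ≤ LinearMap.range mulByG := by
    intro x hx
    obtain ⟨p, rfl⟩ := Ideal.Quotient.mk_surjective x
    obtain ⟨b, hb, c, hc, rfl⟩ := Submodule.mem_sup.mp (Ideal.Quotient.eq_zero_iff_mem.mp hx)
    obtain ⟨a, rfl⟩ := Ideal.mem_span_singleton'.mp hc
    refine ⟨Ideal.Quotient.mk J a, Ideal.Quotient.eq.mpr ?_⟩
    convert I.neg_mem hb using 1
    rw [LinearMap.mulLeft_apply]
    ring
  rw [← LinearMap.rank_range_add_rank_ker toSup]
  exact add_le_add (Submodule.rank_le _) ((Submodule.rank_mono ker_le).trans (rank_range_le mulByG))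

end CodimensionBounds

section ElementarySymmetric

variable {ι R : Type*} [CommRing R]

/-- The elementary symmetric polynomial `e_d` in the variables indexed by `T`. -/
def esymmOn (R : Type*) [CommRing R] (T : Finset ι) (d : ℕ) : MvPolynomial ι R :=
  (T.val.map X).esymm d

theorem esymmOn_eq_sum (T : Finset ι) (d : ℕ) :
    esymmOn R T d = ∑ s ∈ T.powersetCard d, ∏ j ∈ s, X j :=
  Finset.esymm_map_val X T d

theorem esymmOn_zero (T : Finset ι) : esymmOn R T 0 = 1 := by simp [esymmOn_eq_sum]

theorem esymmOn_of_card_lt {T : Finset ι} {d : ℕ} (h : T.card < d) : esymmOn R T d = 0 := by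
  simp [esymmOn_eq_sum, Finset.powersetCard_eq_empty.mpr h]

theorem isHomogeneous_esymmOn (T : Finset ι) (d : ℕ) : (esymmOn R T d).IsHomogeneous d := by
  rw [esymmOn_eq_sum]
  refine IsHomogeneous.sum _ _ _ fun s hs => ?_
  simpa [(Finset.mem_powersetCard.mp hs).2] using
    IsHomogeneous.prod s _ (fun _ => 1) fun j _ => isHomogeneous_X R j

theorem esymmOn_insert_succ [DecidableEq ι] {T : Finset ι} {a : ι} (ha : a ∉ T) (d : ℕ) :
    esymmOn R (insert a T) (d + 1) = esymmOn R T (d + 1) + X a * esymmOn R T d := by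
  rw [esymmOn, Finset.insert_val_of_notMem ha, Multiset.map_cons, Multiset.esymm,
    Multiset.powersetCard_cons, Multiset.map_add, Multiset.sum_add, Multiset.map_map]
  simp [esymmOn, Multiset.esymm, Multiset.sum_map_mul_left]

end ElementarySymmetric

section GeneralizedCoinvariants

variable {ι R : Type*} [CommRing R]

/-- The generalized coinvariant ideal: generated by `x_i ^ k` and the top `s` elementary symmetric
polynomials in the variables indexed by `T`, together with all the other variables, so that the
quotient only involves the variables in `T`. -/
def coinvIdeal (R : Type*) [CommRing R] (T : Finset ι) (k s : ℕ) : Ideal (MvPolynomial ι R) :=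
  Ideal.span ({g | ∃ i ∈ T, g = X i ^ k} ∪ {g | ∃ i ∉ T, g = X i} ∪
    {g | ∃ d, T.card < d + s ∧ g = esymmOn R T d})

theorem X_pow_mem_coinvIdeal {T : Finset ι} {i : ι} (hi : i ∈ T) (k s : ℕ) :
    X i ^ k ∈ coinvIdeal R T k s :=
  Ideal.subset_span (Or.inl (Or.inl ⟨i, hi, rfl⟩))

theorem X_mem_coinvIdeal {T : Finset ι} {i : ι} (hi : i ∉ T) (k s : ℕ) :
    X i ∈ coinvIdeal R T k s :=
  Ideal.subset_span (Or.inl (Or.inr ⟨i, hi, rfl⟩))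

theorem esymmOn_mem_coinvIdeal {T : Finset ι} {d s : ℕ} (h : T.card < d + s) (k : ℕ) :
    esymmOn R T d ∈ coinvIdeal R T k s :=
  Ideal.subset_span (Or.inr ⟨d, h, rfl⟩)

theorem mul_mem_of_mem_coinvIdeal {T : Finset ι} {k s : ℕ} {I : Ideal (MvPolynomial ι R)}
    {g : MvPolynomial ι R} (hpow : ∀ i ∈ T, g * X i ^ k ∈ I) (hX : ∀ i ∉ T, g * X i ∈ I)
    (hesymm : ∀ d, T.card < d + s → g * esymmOn R T d ∈ I) :
    ∀ p ∈ coinvIdeal R T k s, g * p ∈ I := by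
  suffices h : coinvIdeal R T k s ≤ Submodule.comap (LinearMap.mulLeft (MvPolynomial ι R) g) I from
    fun p hp => h hp
  refine Ideal.span_le.mpr ?_
  rintro _ ((⟨i, hi, rfl⟩ | ⟨i, hi, rfl⟩) | ⟨d, hd, rfl⟩)
  exacts [hpow i hi, hX i hi, hesymm d hd]

variable {T : Finset ι} {a : ι}

theorem X_pow_mul_esymmOn_mem_coinvIdeal [DecidableEq ι] (ha : a ∉ T) (k : ℕ) {s : ℕ} (m d : ℕ)
    (hs : T.card < d + s) (hm : T.card < d + m) :
    X a ^ m * esymmOn R T d ∈ coinvIdeal R (insert a T) k s := by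
  induction m generalizing d with
  | zero => simp [esymmOn_of_card_lt (show T.card < d by lia)]
  | succ m ih =>
    have h : X a ^ (m + 1) * esymmOn R T d =
        X a ^ m * esymmOn R (insert a T) (d + 1) - X a ^ m * esymmOn R T (d + 1) := by
      rw [esymmOn_insert_succ ha]; ring
    rw [h]
    refine Ideal.sub_mem _ (Ideal.mul_mem_left _ _ (esymmOn_mem_coinvIdeal ?_ k))
      (ih _ (by lia) (by lia))
    rw [Finset.card_insert_of_notMem ha]
    lia

theorem X_pow_mul_esymmOn_mem_sup [DecidableEq ι] (ha : a ∉ T) (k : ℕ) {s : ℕ} (j d : ℕ)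
    (hs : T.card + 1 < d + s) :
    X a ^ j * esymmOn R T d ∈ coinvIdeal R (insert a T) k s ⊔ Ideal.span {X a ^ (j + 1)} := by
  have hcard := Finset.card_insert_of_notMem ha
  cases d with
  | zero =>
    refine Ideal.mul_mem_left _ _ (Ideal.mem_sup_left ?_)
    rw [esymmOn_zero, ← esymmOn_zero (insert a T)]
    exact esymmOn_mem_coinvIdeal (by lia) k
  | succ d =>
    have h : X a ^ j * esymmOn R T (d + 1) =
        X a ^ j * esymmOn R (insert a T) (d + 1) - esymmOn R T d * X a ^ (j + 1) := by
      rw [esymmOn_insert_succ ha]; ring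
    rw [h]
    exact Ideal.sub_mem _
      (Ideal.mul_mem_left _ _ (Ideal.mem_sup_left (esymmOn_mem_coinvIdeal (by lia) k)))
      (Ideal.mul_mem_left _ _ (Ideal.mem_sup_right (Ideal.mem_span_singleton_self _)))

variable {K : Type*} [CommRing K] [IsDomain K]

/-- The number of maps from a set of `t` elements to `{1, …, k}` whose image contains
`{1, …, s}`, by recursion on `t`. For `s > k` the value is junk. -/
def coverCount (k : ℕ) : ℕ → ℕ → ℕ
  | 0, s => if s = 0 then 1 else 0
  | t + 1, s => s * coverCount k t (s - 1) + (k - s) * coverCount k t s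

theorem rank_coinvIdeal_empty_le (k s : ℕ) :
    Module.rank K (MvPolynomial ι K ⧸ coinvIdeal K (∅ : Finset ι) k s) ≤ coverCount k 0 s := by
  rcases eq_or_ne s 0 with rfl | hs
  · have surjective : Function.Surjective
        (Algebra.linearMap K (MvPolynomial ι K ⧸ coinvIdeal K (∅ : Finset ι) k 0)) := fun x => by
      obtain ⟨p, rfl⟩ := Ideal.Quotient.mk_surjective x
      induction p using MvPolynomial.induction_on with
      | C c => exact ⟨c, rfl⟩
      | add p q hp hq =>
        obtain ⟨⟨b, hb⟩, c, hc⟩ := And.intro hp hq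
        exact ⟨b + c, by rw [map_add, hb, hc, map_add]⟩
      | mul_X p i _ =>
        have hX := Ideal.Quotient.eq_zero_iff_mem.mpr
          (X_mem_coinvIdeal (R := K) (Finset.notMem_empty i) k 0)
        exact ⟨0, by rw [map_mul, hX, mul_zero, map_zero]⟩
    simpa [coverCount] using LinearMap.lift_rank_le_of_surjective _ surjective
  · rw [rank_quotient_eq_zero_of_one_mem]
    · exact Nat.cast_nonneg _
    · rw [← esymmOn_zero (∅ : Finset ι)]
      exact esymmOn_mem_coinvIdeal (by simpa using Nat.pos_of_ne_zero hs) k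

theorem rank_coinvIdeal_sup_pow_succ_le [DecidableEq ι] {k s s' j : ℕ}
    (h : ∀ d, T.card < d + s' →
      X a ^ j * esymmOn K T d ∈ coinvIdeal K (insert a T) k s ⊔ Ideal.span {X a ^ (j + 1)}) :
    Module.rank K (MvPolynomial ι K ⧸
        (coinvIdeal K (insert a T) k s ⊔ Ideal.span {X a ^ (j + 1)})) ≤
      Module.rank K (MvPolynomial ι K ⧸ (coinvIdeal K (insert a T) k s ⊔ Ideal.span {X a ^ j})) +
        Module.rank K (MvPolynomial ι K ⧸ coinvIdeal K T k s') := by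
  refine (rank_quotient_le_add (g := X a ^ j) (mul_mem_of_mem_coinvIdeal ?_ ?_ h)).trans
    (add_le_add_left (rank_quotient_le_of_le (sup_le_sup_right le_sup_left _)) _)
  · exact fun i hi => Ideal.mul_mem_left _ _ (Ideal.mem_sup_left
      (X_pow_mem_coinvIdeal (Finset.mem_insert_of_mem hi) k s))
  · intro i hi
    rcases eq_or_ne i a with rfl | hia
    · exact Ideal.mem_sup_right (Ideal.mem_span_singleton.mpr (pow_succ (X i) j).dvd)
    · exact Ideal.mul_mem_left _ _ (Ideal.mem_sup_left (X_mem_coinvIdeal (by simp [hi, hia]) k s))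

theorem rank_coinvIdeal_sup_pow_le [DecidableEq ι] {k s : ℕ} (ha : a ∉ T) {N M : ℕ}
    (hN : Module.rank K (MvPolynomial ι K ⧸ coinvIdeal K T k (s - 1)) ≤ N)
    (hM : Module.rank K (MvPolynomial ι K ⧸ coinvIdeal K T k s) ≤ M) (j : ℕ) :
    Module.rank K (MvPolynomial ι K ⧸ (coinvIdeal K (insert a T) k s ⊔ Ideal.span {X a ^ j})) ≤
      (min j s * N + (j - s) * M : ℕ) := by
  induction j with
  | zero =>
    rw [rank_quotient_eq_zero_of_one_mem]
    · exact Nat.cast_nonneg _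
    · rw [← pow_zero (X a)]
      exact Ideal.mem_sup_right (Ideal.mem_span_singleton_self _)
  | succ j ih =>
    -- `x_a ^ j * e_d(T)` lies in the ideal of step `j + 1` for all `d` in the range of `s - 1`, and
    -- once `s ≤ j` even in the range of `s`: so `s` of the steps cost `N` and the others `M`.
    rcases lt_or_ge j s with hj | hj
    · have step := (rank_coinvIdeal_sup_pow_succ_le fun d hd =>
        X_pow_mul_esymmOn_mem_sup ha k j d (by lia)).trans (add_le_add ih hN)
      refine step.trans_eq ?_
      rw [min_eq_left hj.le, min_eq_left hj, Nat.sub_eq_zero_of_le hj.le, Nat.sub_eq_zero_of_le hj]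
      push_cast
      ring
    · have step := (rank_coinvIdeal_sup_pow_succ_le fun d hd => Ideal.mem_sup_left
        (X_pow_mul_esymmOn_mem_coinvIdeal ha k j d hd (by lia))).trans (add_le_add ih hM)
      refine step.trans_eq ?_
      rw [min_eq_right hj, min_eq_right (by lia : s ≤ j + 1), Nat.sub_add_comm hj]
      push_cast
      ring

theorem rank_coinvIdeal_le (T : Finset ι) {k s : ℕ} (hs : s ≤ k) :
    Module.rank K (MvPolynomial ι K ⧸ coinvIdeal K T k s) ≤ coverCount k T.card s := by
  classical
  induction T using Finset.induction_on generalizing s with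
  | empty => exact rank_coinvIdeal_empty_le k s
  | insert a T ha ih =>
    have hsup := rank_coinvIdeal_sup_pow_le ha (ih (by lia : s - 1 ≤ k)) (ih hs) k
    have hpow : Ideal.span {X a ^ k} ≤ coinvIdeal K (insert a T) k s :=
      (Ideal.span_singleton_le_iff_mem _).mpr
        (X_pow_mem_coinvIdeal (Finset.mem_insert_self a T) k s)
    rw [Finset.card_insert_of_notMem ha]
    rwa [sup_of_le_left hpow, min_eq_right hs] at hsup

end GeneralizedCoinvariants

section CodimensionOfJ

variable {n : ℕ}

theorem esymmOmit_eq_esymmOn (i : Fin n) (d : ℕ) :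
    esymmOmit i d = esymmOn ℚ (Finset.univ.erase i) d :=
  (esymmOn_eq_sum _ d).symm

theorem esymm_eq_esymmOn_univ (d : ℕ) : esymm (Fin n) ℚ d = esymmOn ℚ Finset.univ d :=
  (esymmOn_eq_sum _ d).symm

theorem esymmOn_univ_succ (i : Fin n) (d : ℕ) :
    esymmOn ℚ Finset.univ (d + 1) = esymmOmit i (d + 1) + X i * esymmOmit i d := by
  rw [esymmOmit_eq_esymmOn, esymmOmit_eq_esymmOn,
    ← esymmOn_insert_succ (Finset.notMem_erase i _), Finset.insert_erase (Finset.mem_univ i)]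

theorem X_pow_mul_esymmOmit_mem_idealJ (i : Fin n) {d m : ℕ} (h : n ≤ m + d) :
    X i ^ d * esymmOmit i m ∈ idealJ n := by
  rcases lt_or_ge m n with hm | hm
  · refine Ideal.subset_span ⟨i, d, n - m, by lia, by lia, by lia, ?_⟩
    rw [Nat.sub_sub_self hm.le]
  · have hcard : (Finset.univ.erase i).card < m := by
      rw [Finset.card_erase_of_mem (Finset.mem_univ i), Finset.card_fin]
      have := i.pos
      lia
    rw [esymmOmit_eq_esymmOn, esymmOn_of_card_lt hcard, mul_zero]
    exact zero_mem _

theorem esymmOn_univ_mem_idealJGE {k d : ℕ} (h : n < d + k) :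
    esymmOn ℚ Finset.univ d ∈ idealJGE n k := by
  rcases le_or_gt d n with hd | hd
  · exact Ideal.mem_sup_right (Ideal.subset_span ⟨d, h, hd, (esymm_eq_esymmOn_univ d).symm⟩)
  · rw [esymmOn_of_card_lt (by simpa using hd)]
    exact zero_mem _

theorem esymmOn_univ_mul_X_pow_mem_idealJ (i : Fin n) {k m : ℕ} (h : n ≤ m + k) :
    esymmOn ℚ Finset.univ m * X i ^ k ∈ idealJ n := by
  cases m with
  | zero =>
    have hk := X_pow_mul_esymmOmit_mem_idealJ i (m := 0) h
    rwa [esymmOmit_eq_esymmOn, esymmOn_zero, mul_one, ← one_mul (X i ^ k),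
      ← esymmOn_zero Finset.univ] at hk
  | succ m =>
    have hk := X_pow_mul_esymmOmit_mem_idealJ i h
    have hk_succ := X_pow_mul_esymmOmit_mem_idealJ i (d := k + 1) (m := m) (by lia)
    rw [esymmOn_univ_succ i]
    convert Ideal.add_mem _ hk hk_succ using 1
    ring

theorem esymmOn_univ_mul_mem_idealJGE {k m : ℕ} (h : n ≤ m + k) :
    ∀ p ∈ coinvIdeal ℚ Finset.univ k k, esymmOn ℚ Finset.univ m * p ∈ idealJGE n k :=
  mul_mem_of_mem_coinvIdeal
    (fun i _ => Ideal.mem_sup_left (esymmOn_univ_mul_X_pow_mem_idealJ i h))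
    (fun i hi => absurd (Finset.mem_univ i) hi)
    fun _ hd => Ideal.mul_mem_left _ _ (esymmOn_univ_mem_idealJGE (by simpa using hd))

theorem idealJGE_succ_le (n k : ℕ) :
    idealJGE n (k + 1) ≤ idealJGE n k ⊔ Ideal.span {esymmOn ℚ Finset.univ (n - k)} := by
  refine sup_le (le_sup_left.trans le_sup_left) (Ideal.span_le.mpr ?_)
  rintro _ ⟨d, hd, hdn, rfl⟩
  rw [esymm_eq_esymmOn_univ]
  rcases eq_or_ne d (n - k) with rfl | hne
  · exact Ideal.mem_sup_right (Ideal.mem_span_singleton_self _)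
  · exact Ideal.mem_sup_left (esymmOn_univ_mem_idealJGE (by lia))

theorem rank_ringSGE_le {k : ℕ} (hk : k ≤ n + 1) :
    Module.rank ℚ (RingSGE n k) ≤ (∑ j ∈ Finset.Ico k (n + 1), coverCount j n j : ℕ) := by
  induction hk using Nat.decreasingInduction with
  | self =>
    rw [rank_quotient_eq_zero_of_one_mem]
    · exact Nat.cast_nonneg _
    · rw [← esymmOn_zero Finset.univ]
      exact esymmOn_univ_mem_idealJGE (by lia)
  | of_succ k hk ih =>
    have hcoinv := rank_coinvIdeal_le (K := ℚ) (Finset.univ : Finset (Fin n)) (le_refl k)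
    rw [Finset.card_fin] at hcoinv
    refine (rank_quotient_le_add (esymmOn_univ_mul_mem_idealJGE (m := n - k) (by lia))).trans ?_
    refine (add_le_add ((rank_quotient_le_of_le (idealJGE_succ_le n k)).trans ih)
      hcoinv).trans_eq ?_
    rw [Finset.sum_eq_sum_Ico_succ_bot hk, add_comm, Nat.cast_add]

end CodimensionOfJ

section Counting

theorem card_cover_succ {γ : Type*} [Finite γ] [DecidableEq γ] (n : ℕ) (S : Finset γ) :
    Nat.card {f : Fin (n + 1) → γ // (S : Set γ) ⊆ Set.range f} =
      Nat.card (Σ a, {f : Fin n → γ // (S.erase a : Set γ) ⊆ Set.range f}) :=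
  Nat.card_congr <| ((Fin.consEquiv fun _ => γ).symm.subtypeEquiv fun f => by
    rw [Finset.coe_erase, Set.sdiff_singleton_subset_iff, ← Fin.range_cons]
    exact iff_of_eq (congrArg _ (congrArg _ (Fin.cons_self_tail f).symm))).trans
      (Equiv.subtypeProdEquivSigmaSubtype
        fun a (f : Fin n → γ) => (S.erase a : Set γ) ⊆ Set.range f)

theorem coverCount_eq_card {γ : Type*} [Fintype γ] (n : ℕ) (S : Finset γ) :
    coverCount (Fintype.card γ) n S.card =
      Nat.card {f : Fin n → γ // (S : Set γ) ⊆ Set.range f} := by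
  classical
  induction n generalizing S with
  | zero =>
    rcases S.eq_empty_or_nonempty with rfl | hS
    · simp [coverCount]
    · have : IsEmpty {f : Fin 0 → γ // (S : Set γ) ⊆ Set.range f} :=
        ⟨fun f => hS.coe_sort.elim fun c => (f.2 c.2).elim fun i _ => i.elim0⟩
      rw [Nat.card_of_isEmpty, coverCount, if_neg hS.card_ne_zero]
  | succ n ih =>
    have hmem : ∀ a ∈ S, coverCount (Fintype.card γ) n (S.erase a).card =
        coverCount (Fintype.card γ) n (S.card - 1) := fun a ha => by
      rw [Finset.card_erase_of_mem ha]
    have hnotMem : ∀ a ∈ Sᶜ, coverCount (Fintype.card γ) n (S.erase a).card =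
        coverCount (Fintype.card γ) n S.card := fun a ha => by
      rw [Finset.erase_eq_of_notMem (Finset.mem_compl.mp ha)]
    simp only [card_cover_succ, Nat.card_sigma, ← ih]
    rw [← Finset.sum_add_sum_compl S, Finset.sum_congr rfl hmem, Finset.sum_congr rfl hnotMem]
    simp [coverCount, Finset.card_compl]

theorem coverCount_self_eq_card_surjective (n j : ℕ) :
    coverCount j n j = Nat.card {f : Fin n → Fin j // Function.Surjective f} := by
  have h := coverCount_eq_card n (Finset.univ : Finset (Fin j))
  simpa only [Finset.card_univ, Fintype.card_fin, Finset.coe_univ, Set.univ_subset_iff,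
    Set.range_eq_univ] using h

variable {n j : ℕ}

/-- The word of a map to `{0, …, j - 1}`, with all values shifted by one. -/
def wordOfMap (f : Fin n → Fin j) (i : Fin n) : ℕ+ :=
  Nat.succPNat (f i)

theorem mem_range_wordOfMap {f : Fin n → Fin j} (hf : Function.Surjective f) {m : ℕ+} :
    m ∈ Set.range (wordOfMap f) ↔ (m : ℕ) ≤ j := by
  constructor
  · rintro ⟨i, rfl⟩
    exact (f i).isLt
  · intro hm
    obtain ⟨i, hi⟩ := hf ⟨m.natPred, by rwa [Nat.lt_iff_add_one_le, PNat.natPred_add_one]⟩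
    exact ⟨i, by rw [wordOfMap, hi, PNat.succPNat_natPred]⟩

theorem wordOfMap_injective : Function.Injective (wordOfMap (n := n) (j := j)) :=
  fun _ _ h => funext fun i => Fin.ext (Nat.succPNat_injective (congrFun h i))

theorem isPacked_wordOfMap {f : Fin n → Fin j} (hf : Function.Surjective f) :
    IsPacked (wordOfMap f) := by
  intro m hm
  rw [mem_range_wordOfMap hf] at hm ⊢
  exact (Nat.le_succ m).trans hm

theorem eq_of_wordOfMap_eq {j' : ℕ} {f : Fin n → Fin j} {f' : Fin n → Fin j'}
    (hf : Function.Surjective f) (hf' : Function.Surjective f')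
    (h : wordOfMap f = wordOfMap f') : j = j' := by
  have hiff (m : ℕ+) : (m : ℕ) ≤ j ↔ (m : ℕ) ≤ j' := by
    rw [← mem_range_wordOfMap hf, ← mem_range_wordOfMap hf', h]
  refine le_antisymm ?_ ?_
  · exact j.eq_zero_or_pos.elim (fun hj => hj ▸ j'.zero_le) fun hj => (hiff ⟨j, hj⟩).mp le_rfl
  · exact j'.eq_zero_or_pos.elim (fun hj => hj ▸ j.zero_le) fun hj => (hiff ⟨j', hj⟩).mpr le_rfl

instance (n k : ℕ) : Finite (PackedWordGE n k) :=
  Finite.of_injective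
    (fun w j => (⟨w.1 j, Nat.lt_succ_of_le (w.2.1.letter_le j)⟩ : Fin (n + 1)))
    fun _ _ h => Subtype.ext <| funext fun j => PNat.eq (Fin.mk.inj_iff.mp (congrFun h j))

theorem sum_coverCount_le (n k : ℕ) :
    ∑ j ∈ Finset.Ico k (n + 1), coverCount j n j ≤ Nat.card (PackedWordGE n k) := by
  simp only [coverCount_self_eq_card_surjective]
  rw [← Finset.sum_coe_sort, ← Nat.card_sigma]
  let toWord (p : Σ j : Finset.Ico k (n + 1), {f : Fin n → Fin j // Function.Surjective f}) :
      PackedWordGE n k :=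
    ⟨wordOfMap p.2.1, isPacked_wordOfMap p.2.2, fun m hm =>
      (mem_range_wordOfMap p.2.2).mpr (hm.trans (Finset.mem_Ico.mp p.1.2).1)⟩
  refine Nat.card_le_card_of_injective toWord ?_
  rintro ⟨⟨j, hj⟩, f⟩ ⟨⟨j', hj'⟩, f'⟩ h
  have hword : wordOfMap f.1 = wordOfMap f'.1 := congrArg Subtype.val h
  obtain rfl := eq_of_wordOfMap_eq f.2 f'.2 hword
  exact congrArg _ (Subtype.ext (wordOfMap_injective hword))

end Counting

/-! ### Leading forms -/

section LeadingForms

variable {R A V : Type*} [CommRing R] [CommRing A] [Algebra R A] [AddCommGroup V] [Module R V]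
  (𝒜 : ℕ → Submodule R A)

/-- The elements all of whose homogeneous components have degree less than `d`. -/
def degreeLT (d : ℕ) : Submodule R A :=
  ⨆ i < d, 𝒜 i

/-- `g` is the component of degree `d` of `f`, and `f` has no component of higher degree. The form
`g` may be zero. -/
def HasLeadingForm (f g : A) (d : ℕ) : Prop :=
  g ∈ 𝒜 d ∧ f - g ∈ degreeLT 𝒜 d

/-- The ideal of leading forms of the elements of `I`, i.e. the associated graded ideal of `I`. -/
def leadingFormIdeal (I : Ideal A) : Ideal A :=
  Ideal.span {g | ∃ f ∈ I, ∃ d, HasLeadingForm 𝒜 f g d}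

variable {𝒜}

theorem mem_degreeLT_of_lt {a : A} {i d : ℕ} (ha : a ∈ 𝒜 i) (hi : i < d) : a ∈ degreeLT 𝒜 d :=
  Submodule.mem_iSup_of_mem i (Submodule.mem_iSup_of_mem hi ha)

theorem degreeLT_mono {d e : ℕ} (h : d ≤ e) : degreeLT 𝒜 d ≤ degreeLT 𝒜 e :=
  iSup₂_le fun _ hi _ ha => mem_degreeLT_of_lt ha (hi.trans_le h)

section GradedMonoid

variable [SetLike.GradedMonoid 𝒜]

theorem mul_mem_degreeLT {a b : A} {d e : ℕ} (ha : a ∈ degreeLT 𝒜 (d + 1))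
    (hb : b ∈ degreeLT 𝒜 e) : a * b ∈ degreeLT 𝒜 (d + e) := by
  suffices h : degreeLT 𝒜 (d + 1) * degreeLT 𝒜 e ≤ degreeLT 𝒜 (d + e) from
    h (Submodule.mul_mem_mul ha hb)
  simp only [degreeLT, Submodule.iSup_mul, Submodule.mul_iSup, iSup_le_iff]
  exact fun i hi j hj => Submodule.mul_le.mpr fun x hx y hy =>
    mem_degreeLT_of_lt (SetLike.mul_mem_graded hx hy) (by lia)

theorem mul_mem_degreeLT_of_mem {a b : A} {d e : ℕ} (ha : a ∈ 𝒜 d) (hb : b ∈ degreeLT 𝒜 e) :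
    a * b ∈ degreeLT 𝒜 (d + e) :=
  mul_mem_degreeLT (mem_degreeLT_of_lt ha d.lt_succ_self) hb

theorem HasLeadingForm.mul {f g f' g' : A} {d d' : ℕ} (h : HasLeadingForm 𝒜 f g d)
    (h' : HasLeadingForm 𝒜 f' g' d') : HasLeadingForm 𝒜 (f * f') (g * g') (d + d') := by
  have hf' : f' ∈ degreeLT 𝒜 (d' + 1) := by
    rw [← sub_add_cancel f' g']
    exact add_mem (degreeLT_mono d'.le_succ h'.2) (mem_degreeLT_of_lt h'.1 d'.lt_succ_self)
  have key : f * f' - g * g' = g * (f' - g') + f' * (f - g) := by ring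
  refine ⟨SetLike.mul_mem_graded h.1 h'.1, ?_⟩
  rw [key]
  refine add_mem (mul_mem_degreeLT_of_mem h.1 h'.2) ?_
  rw [add_comm d]
  exact mul_mem_degreeLT hf' h.2

end GradedMonoid

variable [GradedAlgebra 𝒜]

variable (𝒜) in
/-- The linear map that agrees with `ψ d` on the elements of degree `d`. -/
def ofGradedPieces (ψ : ℕ → A →ₗ[R] V) : A →ₗ[R] V :=
  DirectSum.toModule R ℕ V (fun d => ψ d ∘ₗ (𝒜 d).subtype) ∘ₗ DirectSum.decomposeLinearEquiv 𝒜

theorem ofGradedPieces_of_mem (ψ : ℕ → A →ₗ[R] V) {a : A} {d : ℕ} (ha : a ∈ 𝒜 d) :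
    ofGradedPieces 𝒜 ψ a = ψ d a := by
  lift a to 𝒜 d using ha
  simp [ofGradedPieces]

theorem ofGradedPieces_surjective {φ : A →ₗ[R] V} (hφ : Function.Surjective φ)
    {ψ : ℕ → A →ₗ[R] V} (hψ : ∀ d a, φ a - ψ d a ∈ (degreeLT 𝒜 d).map φ) :
    Function.Surjective (ofGradedPieces 𝒜 ψ) := by
  have graded_le : ∀ d, (𝒜 d).map φ ≤ LinearMap.range (ofGradedPieces 𝒜 ψ) := by
    intro d
    induction d using Nat.strong_induction_on with
    | _ d ih =>
      have lower_le : (degreeLT 𝒜 d).map φ ≤ LinearMap.range (ofGradedPieces 𝒜 ψ) := by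
        simp only [degreeLT, Submodule.map_iSup]
        exact iSup₂_le ih
      rintro _ ⟨a, ha, rfl⟩
      rw [← sub_add_cancel (φ a) (ψ d a), ← ofGradedPieces_of_mem ψ ha]
      refine add_mem (lower_le ?_) ⟨a, rfl⟩
      rw [ofGradedPieces_of_mem ψ ha]
      exact hψ d a
  rw [← LinearMap.range_eq_top, eq_top_iff, ← LinearMap.range_eq_top.mpr hφ, LinearMap.range_eq_map,
    ← (DirectSum.Decomposition.isInternal 𝒜).submodule_iSup_eq_top, Submodule.map_iSup]
  exact iSup_le graded_le

theorem ofGradedPieces_mul_eq_zero {φ : A →ₗ[R] V} {I : Ideal A}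
    (hI : I.restrictScalars R ≤ LinearMap.ker φ) {ψ : ℕ → A →ₗ[R] V}
    (hψ : ∀ d a, φ a ∈ (degreeLT 𝒜 d).map φ → ψ d a = 0) {f g : A} {d : ℕ} (hf : f ∈ I)
    (h : HasLeadingForm 𝒜 f g d) (p : A) : ofGradedPieces 𝒜 ψ (p * g) = 0 := by
  induction p using DirectSum.Decomposition.inductionOn 𝒜 with
  | zero => rw [zero_mul, map_zero]
  | add p q hp hq => rw [add_mul, map_add, hp, hq, add_zero]
  | @homogeneous i p =>
    have lower : φ (p * g) = -φ (p * (f - g)) := by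
      rw [mul_sub, map_sub, LinearMap.mem_ker.mp (hI (I.mul_mem_left (p : A) hf)), zero_sub,
        neg_neg]
    rw [ofGradedPieces_of_mem ψ (SetLike.mul_mem_graded p.2 h.1)]
    refine hψ _ _ ?_
    rw [lower]
    exact neg_mem (Submodule.mem_map_of_mem (mul_mem_degreeLT_of_mem p.2 h.2))

theorem leadingFormIdeal_le_ker_ofGradedPieces {φ : A →ₗ[R] V} {I : Ideal A}
    (hI : I.restrictScalars R ≤ LinearMap.ker φ) {ψ : ℕ → A →ₗ[R] V}
    (hψ : ∀ d a, φ a ∈ (degreeLT 𝒜 d).map φ → ψ d a = 0) :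
    (leadingFormIdeal 𝒜 I).restrictScalars R ≤ LinearMap.ker (ofGradedPieces 𝒜 ψ) := by
  intro x hx
  induction hx using Submodule.closure_induction with
  | zero => exact zero_mem _
  | add x y _ _ hx hy => exact add_mem hx hy
  | smul_mem p g hg =>
    obtain ⟨f, hf, d, h⟩ := hg
    exact ofGradedPieces_mul_eq_zero hI hψ hf h p

end LeadingForms

section EquivariantLeadingForms

variable {G K A V : Type*} [Group G] [Finite G] [Field K] [NeZero (Nat.card G : K)]
  [AddCommGroup V] [Module K V] {τ : Representation K G V}

theorem exists_equivariant_linearMap_ker_eq (F : Subrepresentation τ) :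
    ∃ r : V →ₗ[K] V, LinearMap.ker r = F.toSubmodule ∧ (∀ v, v - r v ∈ F.toSubmodule) ∧
      ∀ g v, r (τ g v) = τ g (r v) := by
  obtain ⟨F', hF'⟩ := exists_isCompl F
  have hcompl : IsCompl F'.toSubmodule F.toSubmodule := by
    refine .symm (.of_eq ?_ ?_)
    · rw [← Subrepresentation.toSubmodule_inf, hF'.inf_eq_bot]; rfl
    · rw [← Subrepresentation.toSubmodule_sup, hF'.sup_eq_top]; rfl
  refine ⟨F'.toSubmodule.projection F.toSubmodule hcompl, Submodule.ker_projection hcompl,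
    Submodule.sub_projection_mem hcompl, fun g v => ?_⟩
  obtain ⟨v', hv', v, hv, rfl⟩ := Submodule.mem_sup.mp (hcompl.sup_eq_top.ge (x := v) trivial)
  simp only [map_add, Submodule.projection_apply_of_mem_left hcompl hv',
    Submodule.projection_apply_of_mem_left hcompl (F'.apply_mem_toSubmodule g hv'),
    (Submodule.projection_apply_eq_zero_iff hcompl).mpr hv,
    (Submodule.projection_apply_eq_zero_iff hcompl).mpr (F.apply_mem_toSubmodule g hv), map_zero]

variable [CommRing A] [Algebra K A] (𝒜 : ℕ → Submodule K A) [GradedAlgebra 𝒜]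

theorem exists_equivariant_surjection_leadingFormIdeal_le_ker {ρ : G → Module.End K A}
    (hρ : ∀ g d, ∀ a ∈ 𝒜 d, ρ g a ∈ 𝒜 d) {φ : A →ₗ[K] V} (hφ : Function.Surjective φ)
    (hφρ : ∀ g a, φ (ρ g a) = τ g (φ a)) {I : Ideal A}
    (hI : I.restrictScalars K ≤ LinearMap.ker φ) :
    ∃ Φ : A →ₗ[K] V, Function.Surjective Φ ∧
      (leadingFormIdeal 𝒜 I).restrictScalars K ≤ LinearMap.ker Φ ∧
      ∀ g a, Φ (ρ g a) = τ g (Φ a) := by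
  have degreeLT_le_comap : ∀ g d, degreeLT 𝒜 d ≤ (degreeLT 𝒜 d).comap (ρ g) := fun g d =>
    iSup₂_le fun i hi a ha => mem_degreeLT_of_lt (hρ g i a ha) hi
  let F (d : ℕ) : Subrepresentation τ :=
    { toSubmodule := (degreeLT 𝒜 d).map φ
      apply_mem_toSubmodule := by
        rintro g _ ⟨a, ha, rfl⟩
        exact ⟨ρ g a, degreeLT_le_comap g d ha, hφρ g a⟩ }
  choose r ker_r sub_r_mem r_comm using fun d => exists_equivariant_linearMap_ker_eq (F d)
  refine ⟨ofGradedPieces 𝒜 fun d => r d ∘ₗ φ,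
    ofGradedPieces_surjective hφ fun d a => sub_r_mem d (φ a),
    leadingFormIdeal_le_ker_ofGradedPieces hI fun d a ha => (ker_r d).ge ha, fun g a => ?_⟩
  induction a using DirectSum.Decomposition.inductionOn 𝒜 with
  | zero => simp only [map_zero]
  | add a b ha hb => simp only [map_add, ha, hb]
  | @homogeneous d a =>
    rw [ofGradedPieces_of_mem _ a.2, ofGradedPieces_of_mem _ (hρ g d a a.2)]
    simp only [LinearMap.comp_apply, hφρ, r_comm]

end EquivariantLeadingForms

/-! ### The inclusion of `Jₙ,ₖ` in `T(Xₙ,ₖ)` -/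

attribute [local instance] MvPolynomial.gradedAlgebra

section AssocGradedIdeal

variable {ι R : Type*} [CommRing R]

theorem degreeLT_succ_le_restrictTotalDegree (d : ℕ) :
    degreeLT (homogeneousSubmodule ι R) (d + 1) ≤ restrictTotalDegree ι R d :=
  iSup₂_le fun i hi f hf => by
    rw [mem_restrictTotalDegree]
    exact (IsHomogeneous.totalDegree_le hf).trans (by lia)

theorem homogeneousComponent_eq_zero_of_mem_degreeLT {f : MvPolynomial ι R} {d : ℕ}
    (hf : f ∈ degreeLT (homogeneousSubmodule ι R) d) : homogeneousComponent d f = 0 := by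
  suffices h : degreeLT (homogeneousSubmodule ι R) d ≤ LinearMap.ker (homogeneousComponent d) from
    h hf
  refine iSup₂_le fun i hi g hg => ?_
  rw [LinearMap.mem_ker, homogeneousComponent_of_mem hg, if_neg hi.ne']

theorem hasLeadingForm_homogeneousComponent (f : MvPolynomial ι R) :
    HasLeadingForm (homogeneousSubmodule ι R) f (homogeneousComponent f.totalDegree f)
      f.totalDegree := by
  refine ⟨homogeneousComponent_mem _ f, ?_⟩
  nth_rw 2 [← sum_homogeneousComponent f]
  rw [Finset.sum_range_succ, add_sub_cancel_right]
  exact Submodule.sum_mem _ fun i hi =>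
    mem_degreeLT_of_lt (homogeneousComponent_mem i f) (Finset.mem_range.mp hi)

variable {f g : MvPolynomial ι R} {d : ℕ}

theorem HasLeadingForm.homogeneousComponent_eq
    (h : HasLeadingForm (homogeneousSubmodule ι R) f g d) : homogeneousComponent d f = g := by
  have := homogeneousComponent_eq_zero_of_mem_degreeLT h.2
  rwa [map_sub, homogeneousComponent_eq_self h.1, sub_eq_zero] at this

theorem HasLeadingForm.totalDegree_eq (h : HasLeadingForm (homogeneousSubmodule ι R) f g d)
    (hg : g ≠ 0) : f.totalDegree = d := by
  refine le_antisymm ?_ (not_lt.mp fun hlt => hg ?_)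
  · rw [← mem_restrictTotalDegree, ← sub_add_cancel f g]
    exact degreeLT_succ_le_restrictTotalDegree d
      (add_mem (degreeLT_mono d.le_succ h.2) (mem_degreeLT_of_lt h.1 d.lt_succ_self))
  · rw [← h.homogeneousComponent_eq, homogeneousComponent_eq_zero _ _ hlt]

theorem assocGradedIdeal_eq_leadingFormIdeal {n : ℕ} (Y : Set (Fin n → ℚ)) :
    assocGradedIdeal Y =
      leadingFormIdeal (homogeneousSubmodule (Fin n) ℚ) (vanishingIdeal ℚ Y) := by
  refine le_antisymm (Ideal.span_mono ?_) (Ideal.span_le.mpr ?_)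
  · rintro _ ⟨f, hf, -, rfl⟩
    exact ⟨f, hf, f.totalDegree, hasLeadingForm_homogeneousComponent f⟩
  · rintro g ⟨f, hf, d, h⟩
    rcases eq_or_ne g 0 with rfl | hg
    · exact zero_mem _
    · refine Ideal.subset_span ⟨f, hf, ?_, ?_⟩
      · rintro rfl
        exact hg (by rw [← h.homogeneousComponent_eq, map_zero])
      · rw [topComponent, h.totalDegree_eq hg, h.homogeneousComponent_eq]

theorem HasLeadingForm.mem_assocGradedIdeal {n : ℕ} {f g : MvPolynomial (Fin n) ℚ} {d : ℕ}
    (h : HasLeadingForm (homogeneousSubmodule (Fin n) ℚ) f g d) {Y : Set (Fin n → ℚ)}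
    (hf : ∀ x ∈ Y, eval x f = 0) : g ∈ assocGradedIdeal Y := by
  rw [assocGradedIdeal_eq_leadingFormIdeal]
  exact Ideal.subset_span ⟨f, fun x hx => by rw [aeval_eq_eval, hf x hx], d, h⟩

end AssocGradedIdeal

section DividedDifferences

variable {ι κ K : Type*}

theorem hasLeadingForm_prod_X_sub_C [CommRing K] (i : ι) (a : κ → K) (S : Finset κ) :
    HasLeadingForm (homogeneousSubmodule ι K) (∏ l ∈ S, (X i - C (a l))) (X i ^ S.card)
      S.card := by
  classical
  have linear (c : K) : HasLeadingForm (homogeneousSubmodule ι K) (X i - C c) (X i) 1 := by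
    refine ⟨isHomogeneous_X K i, ?_⟩
    rw [sub_sub_cancel_left]
    exact neg_mem (mem_degreeLT_of_lt (isHomogeneous_C ι c) one_pos)
  induction S using Finset.induction_on with
  | empty => exact ⟨isHomogeneous_one ι K, by simp⟩
  | insert l S hl ih =>
    rw [Finset.prod_insert hl, Finset.card_insert_of_notMem hl, pow_succ', add_comm]
    exact (linear (a l)).mul ih

theorem prod_C_add_X_eq_sum [CommRing K] (T : Finset ι) (c : K) : ∏ j ∈ T, (C c + X j) =
    ∑ i ∈ Finset.range (T.card + 1), C (c ^ (T.card - i)) * esymmOn K T i := by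
  have h := congrArg (Polynomial.eval (C c))
    (Multiset.prod_X_add_C_eq_sum_esymm (T.val.map (X : ι → MvPolynomial ι K)))
  simp only [Polynomial.eval_multiset_prod, Multiset.map_map, Function.comp_def,
    Polynomial.eval_add, Polynomial.eval_X, Polynomial.eval_C, Polynomial.eval_finsetSum,
    Polynomial.eval_mul, Polynomial.eval_pow, Multiset.card_map, Finset.card_val] at h
  refine h.trans (Finset.sum_congr rfl fun i _ => ?_)
  rw [mul_comm, map_pow]
  rfl

variable [Field K] [DecidableEq κ] {b : κ → K} {S : Finset κ} {T : Finset ι}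

theorem sum_nodalWeight_mul_pow (hb : Set.InjOn b S) {e : ℕ} (he : e < S.card) :
    ∑ l ∈ S, Lagrange.nodalWeight S b l * b l ^ e = if e + 1 = S.card then 1 else 0 := by
  have h := Lagrange.coeff_eq_sum hb (P := Polynomial.X ^ e)
    (by rw [Polynomial.degree_X_pow]; exact_mod_cast he)
  simp only [Polynomial.coeff_X_pow, Polynomial.eval_pow, Polynomial.eval_X,
    show S.card - 1 = e ↔ e + 1 = S.card by lia] at h
  rw [h]
  refine Finset.sum_congr rfl fun l _ => ?_
  rw [Lagrange.nodalWeight, Finset.prod_inv_distrib, div_eq_inv_mul]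

/-- The divided difference at the nodes `b_l`, `l ∈ S`, of the polynomial `∏ (t + x_j)`, `j ∈ T`,
in the variable `t`. -/
def dividedDifference (b : κ → K) (S : Finset κ) (T : Finset ι) : MvPolynomial ι K :=
  ∑ l ∈ S, C (Lagrange.nodalWeight S b l) * ∏ j ∈ T, (C (b l) + X j)

theorem dividedDifference_eq_sum (b : κ → K) (S : Finset κ) (T : Finset ι) :
    dividedDifference b S T = ∑ i ∈ Finset.range (T.card + 1),
      C (∑ l ∈ S, Lagrange.nodalWeight S b l * b l ^ (T.card - i)) * esymmOn K T i := by
  simp only [dividedDifference, prod_C_add_X_eq_sum, Finset.mul_sum, map_sum, Finset.sum_mul,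
    map_mul, mul_assoc]
  exact Finset.sum_comm

theorem hasLeadingForm_dividedDifference (hb : Set.InjOn b S) {d m : ℕ} (hS : S.card = m + 1)
    (hT : T.card = d + m) :
    HasLeadingForm (homogeneousSubmodule ι K) (dividedDifference b S T) (esymmOn K T d) d := by
  have truncate : dividedDifference b S T = ∑ i ∈ Finset.range (d + 1),
      C (∑ l ∈ S, Lagrange.nodalWeight S b l * b l ^ (T.card - i)) * esymmOn K T i := by
    rw [dividedDifference_eq_sum]
    refine (Finset.sum_subset (Finset.range_mono (by lia)) fun i hi hid => ?_).symm
    rw [Finset.mem_range] at hi hid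
    rw [sum_nodalWeight_mul_pow hb (by lia), if_neg (by lia), map_zero, zero_mul]
  refine ⟨isHomogeneous_esymmOn T d, ?_⟩
  rw [truncate, Finset.sum_range_succ, sum_nodalWeight_mul_pow hb (by lia), if_pos (by lia),
    map_one, one_mul, add_sub_cancel_right]
  exact sum_mem fun i hi =>
    mem_degreeLT_of_lt ((isHomogeneous_esymmOn T i).C_mul _) (Finset.mem_range.mp hi)

theorem eval_dividedDifference_eq_zero {x : ι → K} (h : ∀ l ∈ S, ∃ j ∈ T, b l + x j = 0) :
    eval x (dividedDifference b S T) = 0 := by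
  rw [dividedDifference, map_sum]
  refine Finset.sum_eq_zero fun l hl => ?_
  obtain ⟨j, hj, hjl⟩ := h l hl
  rw [map_mul, map_prod, Finset.prod_eq_zero hj (by simp [hjl]), mul_zero]

end DividedDifferences

section InclusionOfJ

variable {n k : ℕ} {α : Fin n → ℚ} {w : Fin n → ℕ+}

theorem point_eq_of_eq_succPNat (α : Fin n → ℚ) (hw : IsPacked w) {j l : Fin n}
    (h : w j = Nat.succPNat l) : point α w hw j = α l := by
  simp [point, h]

theorem card_filter_val_lt_of_le {r : ℕ} (hr : r ≤ n) :
    (Finset.univ.filter fun l : Fin n => l.val < r).card = r := by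
  rw [Fin.card_filter_val_lt, min_eq_right hr]

theorem esymm_mem_assocGradedIdeal (hkn : k ≤ n) (hα : Function.Injective α) {d : ℕ}
    (hd : n + 1 ≤ d + k) (hdn : d ≤ n) : esymm (Fin n) ℚ d ∈ assocGradedIdeal (locus α k) := by
  rw [esymm_eq_esymmOn_univ]
  have hS := card_filter_val_lt_of_le (n := n) (r := n + 1 - d) (by lia)
  have h := hasLeadingForm_dividedDifference (b := fun l => -α l) (neg_injective.comp hα).injOn
    (S := {l | l.val < n + 1 - d}) (T := (Finset.univ : Finset (Fin n))) (d := d) (m := n - d)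
    (by lia) (by simpa using by lia)
  refine h.mem_assocGradedIdeal ?_
  rintro _ ⟨w, rfl⟩
  refine eval_dividedDifference_eq_zero fun l hl => ?_
  obtain ⟨j, hj⟩ := w.2.2 (Nat.succPNat l)
    (by have := (Finset.mem_filter.mp hl).2; rw [Nat.succPNat_coe]; lia)
  exact ⟨j, Finset.mem_univ j, by simp [point_eq_of_eq_succPNat α w.2.1 hj]⟩

theorem eval_point_prod_mul_dividedDifference_eq_zero (hw : IsPacked w) (i : Fin n) (r : ℕ) :
    eval (point α w hw) ((∏ l with l.val < r, (X i - C (α l))) *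
      dividedDifference (fun l => -α l) {l | l.val < r} (Finset.univ.erase i)) = 0 := by
  rw [map_mul]
  rcases le_or_gt (w i : ℕ) r with hle | hlt
  · have hi := hw.letter_le i
    have hpos := (w i).pos
    rw [map_prod, Finset.prod_eq_zero (i := ⟨(w i : ℕ) - 1, by lia⟩), zero_mul]
    · simp; lia
    · simp [point]
  · rw [eval_dividedDifference_eq_zero, mul_zero]
    intro l hl
    have hl : l.val < r := (Finset.mem_filter.mp hl).2
    have hlw : Nat.succPNat l < w i := by rw [← PNat.coe_lt_coe, Nat.succPNat_coe]; lia
    obtain ⟨j, hj⟩ := hw.mem_range_of_le (w i) ⟨i, rfl⟩ _ hlw.le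
    refine ⟨j, Finset.mem_erase.mpr ⟨?_, Finset.mem_univ j⟩,
      by simp [point_eq_of_eq_succPNat α hw hj]⟩
    rintro rfl
    exact hlw.ne' hj

theorem X_pow_mul_esymmOmit_mem_assocGradedIdeal (hα : Function.Injective α) (i : Fin n) {r : ℕ}
    (hr : 1 ≤ r) (hrn : r ≤ n) :
    X i ^ r * esymmOmit i (n - r) ∈ assocGradedIdeal (locus α k) := by
  have hS := card_filter_val_lt_of_le hrn
  have h := (hasLeadingForm_prod_X_sub_C i α {l | l.val < r}).mul
    (hasLeadingForm_dividedDifference (b := fun l => -α l) (neg_injective.comp hα).injOn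
      (S := {l | l.val < r}) (T := Finset.univ.erase i) (d := n - r) (m := r - 1)
      (by lia) (by simpa using by lia))
  rw [hS, ← esymmOmit_eq_esymmOn] at h
  refine h.mem_assocGradedIdeal ?_
  rintro _ ⟨w, rfl⟩
  exact eval_point_prod_mul_dividedDifference_eq_zero w.2.1 i r

theorem idealJGE_le_assocGradedIdeal (hkn : k ≤ n) (hα : Function.Injective α) :
    idealJGE n k ≤ assocGradedIdeal (locus α k) := by
  refine sup_le (Ideal.span_le.mpr ?_) (Ideal.span_le.mpr ?_)
  · rintro _ ⟨i, d, r, hr, hrd, hrn, rfl⟩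
    rw [← Nat.sub_add_cancel hrd, pow_add, mul_assoc]
    exact Ideal.mul_mem_left _ _ (X_pow_mul_esymmOmit_mem_assocGradedIdeal hα i hr hrn)
  · rintro _ ⟨d, hd, hdn, rfl⟩
    exact esymm_mem_assocGradedIdeal hkn hα hd hdn

end InclusionOfJ

/-! ### Comparison with the permutation module -/

section EvaluationAtPoints

variable {ι K W : Type*} [Finite W] {pt : W → ι → K}

theorem exists_eval_eq [Field K] (hpt : Function.Injective pt) (u : W → K) :
    ∃ f : MvPolynomial ι K, ∀ w, eval (pt w) f = u w := by
  have coprime : Pairwise (Function.onFun IsCoprime fun w => vanishingIdeal K {pt w}) := by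
    intro v w hvw
    refine Ideal.isCoprime_of_isMaximal fun h : vanishingIdeal K {pt v} = vanishingIdeal K {pt w} =>
      hvw (hpt (funext fun i => ?_))
    have hv : X i - C (pt v i) ∈ vanishingIdeal K {pt w} := by
      rw [← h, mem_vanishingIdeal_singleton_iff]
      simp
    simpa [sub_eq_zero, eq_comm] using (mem_vanishingIdeal_singleton_iff _ _).mp hv
  obtain ⟨f, hf⟩ := Ideal.exists_forall_sub_mem_ideal coprime fun w => C (u w)
  refine ⟨f, fun w => ?_⟩
  simpa [aeval_eq_eval, sub_eq_zero] using (mem_vanishingIdeal_singleton_iff _ _).mp (hf w)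

/-- Evaluation of polynomials at a finite family of points, with values in the free module on the
index set of the family, where the permutation representation lives. -/
def evalPoints [CommRing K] (pt : W → ι → K) : MvPolynomial ι K →ₗ[K] MonoidAlgebra K W :=
  (MonoidAlgebra.coeffLinearEquiv K).symm.toLinearMap ∘ₗ
    (Finsupp.linearEquivFunOnFinite K K W).symm.toLinearMap ∘ₗ
      LinearMap.pi fun w => (aeval (pt w)).toLinearMap

theorem coeff_evalPoints [CommRing K] (pt : W → ι → K) (f : MvPolynomial ι K) (w : W) :
    (evalPoints pt f).coeff w = eval (pt w) f := by
  simp [evalPoints]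

theorem evalPoints_surjective [Field K] (hpt : Function.Injective pt) :
    Function.Surjective (evalPoints pt) := fun u => by
  obtain ⟨f, hf⟩ := exists_eval_eq hpt u.coeff
  exact ⟨f, by ext w; rw [coeff_evalPoints, hf]⟩

theorem vanishingIdeal_range_le_ker_evalPoints [Field K] (pt : W → ι → K) :
    (vanishingIdeal K (Set.range pt)).restrictScalars K ≤ LinearMap.ker (evalPoints pt) := by
  intro f hf
  ext w
  rw [coeff_evalPoints, ← aeval_eq_eval]
  exact mem_vanishingIdeal_iff.mp hf (pt w) ⟨w, rfl⟩

theorem evalPoints_rename [CommRing K] [MulAction (Equiv.Perm ι) W]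
    (hact : ∀ (σ : Equiv.Perm ι) w, pt (σ⁻¹ • w) = pt w ∘ σ) (σ : Equiv.Perm ι)
    (f : MvPolynomial ι K) :
    evalPoints pt (rename σ f) = Representation.ofMulAction K _ W σ (evalPoints pt f) := by
  ext w
  rw [Representation.coeff_ofMulAction, coeff_evalPoints, coeff_evalPoints, eval_rename, hact]

theorem finrank_monoidAlgebra_eq_card (K W : Type*) [CommRing K] [Nontrivial K]
    [Finite W] :
    Module.finrank K (MonoidAlgebra K W) = Nat.card W := by
  have := Fintype.ofFinite W
  rw [(MonoidAlgebra.coeffLinearEquiv K).finrank_eq, Module.finrank_finsupp_self,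
    Nat.card_eq_fintype_card]

end EvaluationAtPoints

section Comparison

theorem eq_ker_of_rank_quotient_le {K U V : Type*} [Field K] [AddCommGroup U] [Module K U]
    [AddCommGroup V] [Module K V] [Module.Finite K U] {p : Submodule K V} {f : V →ₗ[K] U}
    (hp : p ≤ LinearMap.ker f) (hf : Function.Surjective f)
    (hrank : Module.rank K (V ⧸ p) ≤ Module.finrank K U) : p = LinearMap.ker f := by
  have : Module.Finite K (V ⧸ p) :=
    Module.rank_lt_aleph0_iff.mp (hrank.trans_lt Cardinal.natCast_lt_aleph0)
  have surjective : Function.Surjective (p.liftQ f hp) := fun u => by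
    obtain ⟨v, rfl⟩ := hf u
    exact ⟨p.mkQ v, rfl⟩
  have finrank_eq : Module.finrank K (V ⧸ p) = Module.finrank K U :=
    le_antisymm (Module.finrank_le_of_rank_le hrank)
      (LinearMap.finrank_le_finrank_of_surjective surjective)
  have injective :=
    (LinearMap.injective_iff_surjective_of_finrank_eq_finrank finrank_eq).mpr surjective
  exact le_antisymm hp fun v hv => (Submodule.Quotient.mk_eq_zero p).mp
    (injective (by simpa using hv))

variable {n : ℕ} {W : Type*} [Finite W] [MulAction (Equiv.Perm (Fin n)) W]
  {pt : W → Fin n → ℚ}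

theorem exists_equivariant_surjection_assocGradedIdeal_le_ker (hpt : Function.Injective pt)
    (hact : ∀ (σ : Equiv.Perm (Fin n)) w, pt (σ⁻¹ • w) = pt w ∘ σ) :
    ∃ Φ : MvPolynomial (Fin n) ℚ →ₗ[ℚ] MonoidAlgebra ℚ W, Function.Surjective Φ ∧
      (assocGradedIdeal (Set.range pt)).restrictScalars ℚ ≤ LinearMap.ker Φ ∧
      ∀ (σ : Equiv.Perm (Fin n)) f,
        Φ (rename σ f) = Representation.ofMulAction ℚ _ W σ (Φ f) := by
  rw [assocGradedIdeal_eq_leadingFormIdeal]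
  exact exists_equivariant_surjection_leadingFormIdeal_le_ker (homogeneousSubmodule (Fin n) ℚ)
    (ρ := fun σ : Equiv.Perm (Fin n) => (rename σ).toLinearMap)
    (fun _ _ _ hf => hf.rename_isHomogeneous)
    (evalPoints_surjective hpt) (evalPoints_rename hact)
    (vanishingIdeal_range_le_ker_evalPoints pt)

/-- An equivariant surjection `ℚ[x₁, …, xₙ] → V` with kernel `J` identifies the quotient by `J`
with `V` as representations. -/
def quotientRepEquivOfSurjective {V : Type*} [AddCommGroup V] [Module ℚ V]
    {τ : Representation ℚ (Equiv.Perm (Fin n)) V} {J : Ideal (MvPolynomial (Fin n) ℚ)}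
    (hJ : ∀ σ : Equiv.Perm (Fin n), J ≤ J.comap (rename (R := ℚ) σ))
    {Φ : MvPolynomial (Fin n) ℚ →ₗ[ℚ] V} (hsurj : Function.Surjective Φ)
    (hker : J.restrictScalars ℚ = LinearMap.ker Φ)
    (hequiv : ∀ (σ : Equiv.Perm (Fin n)) f, Φ (rename σ f) = τ σ (Φ f)) :
    (quotientRep J hJ).Equiv τ :=
  .mk ((Submodule.quotEquivOfEq _ _ hker).trans (Φ.quotKerEquivOfSurjective hsurj)) fun σ =>
    LinearMap.ext fun x => by
      obtain ⟨f, rfl⟩ := Ideal.Quotient.mk_surjective x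
      exact hequiv σ f

theorem eq_assocGradedIdeal_and_nonempty_equiv (hpt : Function.Injective pt)
    (hact : ∀ (σ : Equiv.Perm (Fin n)) w, pt (σ⁻¹ • w) = pt w ∘ σ)
    {J : Ideal (MvPolynomial (Fin n) ℚ)}
    (hJ : ∀ σ : Equiv.Perm (Fin n), J ≤ J.comap (rename (R := ℚ) σ))
    (hle : J ≤ assocGradedIdeal (Set.range pt))
    (hrank : Module.rank ℚ (MvPolynomial (Fin n) ℚ ⧸ J) ≤ Nat.card W) :
    J = assocGradedIdeal (Set.range pt) ∧
      Nonempty ((quotientRep J hJ).Equiv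
        (Representation.ofMulAction ℚ (Equiv.Perm (Fin n)) W)) := by
  obtain ⟨Φ, hsurj, hker, hequiv⟩ := exists_equivariant_surjection_assocGradedIdeal_le_ker hpt hact
  have hJΦ : J.restrictScalars ℚ = LinearMap.ker Φ :=
    eq_ker_of_rank_quotient_le (le_trans hle hker) hsurj
      (by rwa [finrank_monoidAlgebra_eq_card])
  exact ⟨le_antisymm hle (hker.trans hJΦ.ge), ⟨quotientRepEquivOfSurjective hJ hsurj hJΦ hequiv⟩⟩

end Comparison

section PackedWords

theorem rank_ringSGE_le_card {n k : ℕ} (hkn : k ≤ n) :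
    Module.rank ℚ (RingSGE n k) ≤ Nat.card (PackedWordGE n k) :=
  (rank_ringSGE_le (by lia)).trans (mod_cast sum_coverCount_le n k)

variable {n : ℕ}

theorem point_injective {α : Fin n → ℚ} (hα : Function.Injective α) {v w : Fin n → ℕ+}
    {hv : IsPacked v} {hw : IsPacked w} (h : point α v hv = point α w hw) : v = w := by
  funext j
  have hj := Fin.mk.inj_iff.mp (hα (congrFun h j))
  have hvj := (v j).pos
  have hwj := (w j).pos
  exact PNat.eq (by lia)

/-- The condition on the letters `1, …, k` is empty for `k = 0`. -/
def packedWordEquiv (n : ℕ) : PackedWord n ≃ PackedWordGE n 0 :=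
  Equiv.subtypeEquivRight fun _ =>
    ⟨fun hw => ⟨hw, fun i hi => absurd i.pos (by lia)⟩, And.left⟩

instance (n : ℕ) : Finite (PackedWord n) :=
  Finite.of_equiv _ (packedWordEquiv n).symm

theorem idealJGE_zero (n : ℕ) : idealJGE n 0 = idealJ n := by
  refine le_antisymm (sup_le le_rfl (Ideal.span_le.mpr ?_)) le_sup_left
  rintro _ ⟨d, hd, hdn, -⟩
  lia

theorem locus_zero (α : Fin n → ℚ) :
    locus α 0 = Set.range fun w : PackedWord n => point α w.1 w.2 :=
  ((packedWordEquiv n).surjective.range_comp _).symm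

theorem idealJGE_eq_assocGradedIdeal_and_nonempty_equiv {k : ℕ} (hkn : k ≤ n) {α : Fin n → ℚ}
    (hα : Function.Injective α) :
    idealJGE n k = assocGradedIdeal (locus α k) ∧
      Nonempty ((repSGE n k).Equiv
        (Representation.ofMulAction ℚ (Equiv.Perm (Fin n)) (PackedWordGE n k))) :=
  eq_assocGradedIdeal_and_nonempty_equiv (pt := fun w : PackedWordGE n k => point α w.1 w.2.1)
    (fun _ _ h => Subtype.ext (point_injective hα h)) (fun _ _ => rfl) (idealJGE_le_comap n k)
    (idealJGE_le_assocGradedIdeal hkn hα) (rank_ringSGE_le_card hkn)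

theorem injective_natCast_val (n : ℕ) : Function.Injective fun i : Fin n => (i.val : ℚ) :=
  Nat.cast_injective.comp Fin.val_injective

theorem nonempty_repS_equiv (n : ℕ) : Nonempty ((repS n).Equiv
    (Representation.ofMulAction ℚ (Equiv.Perm (Fin n)) (PackedWord n))) := by
  have hα := injective_natCast_val n
  refine (eq_assocGradedIdeal_and_nonempty_equiv
    (pt := fun w : PackedWord n => point _ w.1 w.2)
    (fun _ _ h => Subtype.ext (point_injective hα h)) (fun _ _ => rfl) (idealJ_le_comap n)
    ?_ ?_).2
  · rw [← idealJGE_zero, ← locus_zero]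
    exact idealJGE_le_assocGradedIdeal n.zero_le hα
  · rw [← idealJGE_zero, Nat.card_congr (packedWordEquiv n)]
    exact rank_ringSGE_le_card n.zero_le

end PackedWords

end PackedWordQuotient
end

open PackedWordQuotient in
theorem mainTheorem2 (n k : ℕ) (hk : 1 ≤ k) (hkn : k ≤ n) :
    (∀ α : Fin n → ℚ, Function.Injective α →
      PackedWordQuotient.idealJGE n k =
        PackedWordQuotient.assocGradedIdeal (PackedWordQuotient.locus α k)) ∧
    Nonempty ((PackedWordQuotient.repSGE n k).Equiv
      (Representation.ofMulAction ℚ (Equiv.Perm (Fin n)) (PackedWordQuotient.PackedWordGE n k))) ∧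
    Nonempty ((PackedWordQuotient.repS n).Equiv
      (Representation.ofMulAction ℚ (Equiv.Perm (Fin n)) (PackedWordQuotient.PackedWord n))) ∧
    Module.Finite ℚ (PackedWordQuotient.RingS n) ∧
    Module.finrank ℚ (PackedWordQuotient.RingS n) =
      Nat.card (PackedWordQuotient.PackedWord n) := by
  have hGE {α : Fin n → ℚ} (hα : Function.Injective α) :=
    idealJGE_eq_assocGradedIdeal_and_nonempty_equiv hkn hα
  obtain ⟨e⟩ := nonempty_repS_equiv n
  exact ⟨fun α hα => (hGE hα).1, (hGE (injective_natCast_val n)).2, ⟨e⟩,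
    .equiv e.toLinearEquiv.symm,
    e.toLinearEquiv.finrank_eq.trans (finrank_monoidAlgebra_eq_card ..)⟩
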